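/- For every $\varepsilon>0$ there exists a finite simple $2$-connected planar cubic graph $G$ such that every closed walk of $G$ visiting all vertices (a traveling salesman tour) has length at least $(1.25-\varepsilon)\,|V(G)|$; that is, $\operatorname{tsp}(G)\ge(1.25-\varepsilon)\,|V(G)|$, where $\operatorname{tsp}(G)$ denotes the length of a shortest closed walk of $G$ visiting all vertices. -/

import Mathlib

/-- A traveling salesman tour of `G`: a closed walk that visits every vertex. -/
def SimpleGraph.Walk.IsTSPTour {V : Type*} {G : SimpleGraph V} {v : V} (w : G.Walk v v) : Prop :=
  ∀ u : V, u ∈ w.support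

/-- `tsp G` is the length of a shortest traveling salesman tour of `G` (see `tsp_isLeast`: the
minimum is attained for every finite connected graph). -/
noncomputable def SimpleGraph.tsp {V : Type*} (G : SimpleGraph V) : ℕ :=
  sInf {l : ℕ | ∃ (v : V) (w : G.Walk v v), w.IsTSPTour ∧ w.length = l}

/-- In a finite connected graph tours exist, so `tsp G` really is the minimum tour length. -/
theorem SimpleGraph.tsp_isLeast {V : Type*} [Finite V] {G : SimpleGraph V} (hG : G.Connected) :
    IsLeast {l : ℕ | ∃ (v : V) (w : G.Walk v v), w.IsTSPTour ∧ w.length = l} G.tsp := by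
  classical
  have : Fintype V := Fintype.ofFinite V
  obtain ⟨v⟩ := hG.nonempty
  have key : ∀ s : Finset V, ∃ w : G.Walk v v, ∀ u ∈ s, u ∈ w.support := by
    intro s
    induction s using Finset.induction_on with
    | empty => exact ⟨.nil, by simp⟩
    | insert a s _ ih =>
      obtain ⟨w, hw⟩ := ih
      obtain ⟨p⟩ := hG.preconnected v a
      refine ⟨(p.append p.reverse).append w, fun u hu => ?_⟩
      rw [SimpleGraph.Walk.mem_support_append_iff, SimpleGraph.Walk.mem_support_append_iff]
      rcases Finset.mem_insert.1 hu with rfl | hu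
      · exact Or.inl (Or.inl p.end_mem_support)
      · exact Or.inr (hw u hu)
  obtain ⟨w, hw⟩ := key Finset.univ
  exact ⟨Nat.sInf_mem ⟨w.length, v, w, fun u => hw u (Finset.mem_univ u), rfl⟩,
    fun _ hl => Nat.sInf_le hl⟩

/-- `G` is 2-connected: it has more than two vertices, is connected, and stays connected after
the deletion of any one vertex. -/
structure SimpleGraph.IsTwoConnected {V : Type*} [Fintype V] (G : SimpleGraph V) : Prop where
  two_lt_card : 2 < Fintype.card V
  connected : G.Connected
  connected_delete : ∀ v : V, (G.induce {v}ᶜ).Connected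

/-- `G` is planar: it has a drawing in the plane in which the vertices are distinct points, each
edge is a simple arc joining its two ends and containing no other vertex, and two distinct
edges meet only in common ends. -/
def SimpleGraph.IsPlanar {V : Type*} (G : SimpleGraph V) : Prop :=
  ∃ (p : V → ℝ × ℝ) (arc : Sym2 V → Set (ℝ × ℝ)),
    Function.Injective p ∧
    (∀ u v : V, G.Adj u v →
      ∃ γ : _root_.Path (p u) (p v), Function.Injective γ ∧ Set.range γ = arc s(u, v)) ∧
    (∀ e ∈ G.edgeSet, ∀ v : V, p v ∈ arc e → v ∈ e) ∧
    (∀ e ∈ G.edgeSet, ∀ f ∈ G.edgeSet, e ≠ f →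
      ∀ x ∈ arc e ∩ arc f, ∃ v : V, v ∈ e ∧ v ∈ f ∧ x = p v)

/-! The graph is a ladder with alternate rungs thickened. In each octagon except the last, `1, 2, 3,
4` span a diamond (`K₄` minus the edge `1 4`) hung between `0` and `5`, while `6 7` is a plain rung.
Two rails join `7, 6` to `0, 5` of the next octagon. Chords at both ends of the row make the graph
cubic. A block has 8 vertices, and a tour spends 10 edges on it on average, whence 10/8 = 1.25.

For the lower bound a tour is reduced to its edge multiplicities: all degrees are even and every cut
is crossed (`IsTourWeight`). Parity makes the two rails into a block both odd or both even. Counting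
a block's inner edges and its outgoing rails, the cost is at least 10, with 1 more when the rails
change from odd to even and 1 less when they change from even to odd (`block_inequality`). The
parity correction is the increment of a potential, so it telescopes, and `k` blocks cost at least
`10 k - 1`.

Two-connectivity holds because an octagon minus a vertex is connected and one deletion cannot
destroy both rails. Planarity is shown by a straight-line drawing in vertical strips, one per
octagon: inside a strip it is a finite integer check, and adjacent strips meet only at vertices. -/

/-! ### The cubic graph and its 2-connectivity -/

/-- A fixed-point free involution on `Fin (k + 1) × Fin 8`; it matches the vertices of a row of
`k + 1` octagons. -/
def octagonMatch (k : ℕ) (x : Fin (k + 1) × Fin 8) : Fin (k + 1) × Fin 8 :=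
  match x with
  | (i, 0) => if i = 0 then (i, 5) else (i - 1, 7)
  | (i, 1) => (i, 3)
  | (i, 2) => if i = Fin.last k then (i, 7) else (i, 4)
  | (i, 3) => (i, 1)
  | (i, 4) => if i = Fin.last k then (i, 6) else (i, 2)
  | (i, 5) => if i = 0 then (i, 0) else (i - 1, 6)
  | (i, 6) => if i = Fin.last k then (i, 4) else (i + 1, 5)
  | (i, 7) => if i = Fin.last k then (i, 2) else (i + 1, 0)

theorem add_one_ne_zero_of_ne_last {k : ℕ} {i : Fin (k + 1)} (h : i ≠ Fin.last k) : i + 1 ≠ 0 := by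
  intro h0
  exact h (by rw [eq_neg_of_add_eq_zero_left h0]; simp [neg_eq_iff_add_eq_zero, add_comm])

theorem sub_one_ne_last_of_ne_zero {k : ℕ} {i : Fin (k + 1)} (h : i ≠ 0) : i - 1 ≠ Fin.last k := by
  intro h0
  exact h (by rw [sub_eq_iff_eq_add.1 h0]; simp)

theorem octagonMatch_involutive (k : ℕ) : Function.Involutive (octagonMatch k) := by
  rintro ⟨i, j⟩
  by_cases h0 : i = 0 <;> by_cases hl : i = Fin.last k <;> fin_cases j <;>
    simp [octagonMatch, h0, hl, add_one_ne_zero_of_ne_last, sub_one_ne_last_of_ne_zero] <;>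
    simp_all

theorem octagonMatch_snd_ne (k : ℕ) (x : Fin (k + 1) × Fin 8) : (octagonMatch k x).2 ≠ x.2 := by
  obtain ⟨i, j⟩ := x
  fin_cases j <;> simp [octagonMatch] <;> split_ifs <;> simp

/-- Addition in `Fin (k + 1)` is cyclic; a fixed point of `+ 1` forces `k = 0`, and then every index
is the last one. -/
theorem add_one_ne_self_of_ne_last {k : ℕ} {i : Fin (k + 1)} (h : i ≠ Fin.last k) : i + 1 ≠ i := by
  intro h0
  have h1 : (1 : Fin (k + 1)) = 0 := by simpa using h0
  exact h (by rw [← mul_one i, ← mul_one (Fin.last k), h1, mul_zero, mul_zero])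

theorem sub_one_ne_self_of_ne_zero {k : ℕ} {i : Fin (k + 1)} (h : i ≠ 0) : i - 1 ≠ i := by
  intro h0
  have h1 : (1 : Fin (k + 1)) = 0 := by rwa [sub_eq_self] at h0
  exact h (by rw [← mul_one i, h1, mul_zero])

theorem octagonMatch_ne_cyclic (k : ℕ) (i : Fin (k + 1)) (j : Fin 8) :
    octagonMatch k (i, j) ≠ (i, j + 1) ∧ octagonMatch k (i, j) ≠ (i, j - 1) := by
  fin_cases j <;> simp only [octagonMatch] <;> (try split_ifs with h) <;>
    refine ⟨fun e => ?_, fun e => ?_⟩ <;>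
    first
    | exact add_one_ne_self_of_ne_last h (congrArg Prod.fst e)
    | exact sub_one_ne_self_of_ne_zero h (congrArg Prod.fst e)
    | exact absurd (congrArg Prod.snd e) (by dsimp only; decide)

/-- A row of `k + 1` octagons whose vertices are additionally matched by `octagonMatch k`. -/
def octagonChain (k : ℕ) : SimpleGraph (Fin (k + 1) × Fin 8) where
  Adj x y := y = (x.1, x.2 + 1) ∨ y = (x.1, x.2 - 1) ∨ y = octagonMatch k x
  symm := ⟨by
    rintro x y (rfl | rfl | rfl)
    · simp
    · simp
    · simp [octagonMatch_involutive k x]⟩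
  loopless := ⟨by
    rintro x (h | h | h)
    · simpa using congrArg Prod.snd h
    · simpa [eq_sub_iff_add_eq] using congrArg Prod.snd h
    · exact octagonMatch_snd_ne k x (congrArg Prod.snd h).symm⟩

namespace octagonChain

variable {k : ℕ}

theorem adj_iff {x y : Fin (k + 1) × Fin 8} : (octagonChain k).Adj x y ↔
    y = (x.1, x.2 + 1) ∨ y = (x.1, x.2 - 1) ∨ y = octagonMatch k x := Iff.rfl

instance : DecidableRel (octagonChain k).Adj := fun _ _ =>
  decidable_of_iff _ adj_iff.symm

theorem neighborFinset_eq (i : Fin (k + 1)) (j : Fin 8) :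
    (octagonChain k).neighborFinset (i, j) = {(i, j + 1), (i, j - 1), octagonMatch k (i, j)} := by
  ext y
  simp [adj_iff]

theorem add_one_ne_sub_one (j : Fin 8) : j + 1 ≠ j - 1 := by
  revert j; decide

theorem sum_neighborFinset {M : Type*} [AddCommMonoid M] (f : Fin (k + 1) × Fin 8 → M)
    (x : Fin (k + 1) × Fin 8) : ∑ y ∈ (octagonChain k).neighborFinset x, f y =
      f (x.1, x.2 + 1) + (f (x.1, x.2 - 1) + f (octagonMatch k x)) := by
  obtain ⟨i, j⟩ := x
  rw [neighborFinset_eq, Finset.sum_insert, Finset.sum_insert, Finset.sum_singleton]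
  · simpa using (octagonMatch_ne_cyclic k i j).2.symm
  · simpa [add_one_ne_sub_one] using (octagonMatch_ne_cyclic k i j).1.symm

theorem isRegularOfDegree : (octagonChain k).IsRegularOfDegree 3 := by
  rintro ⟨i, j⟩
  rw [← SimpleGraph.card_neighborFinset_eq_degree, Finset.card_eq_sum_ones, sum_neighborFinset]
  rfl

theorem adj_succ (i : Fin (k + 1)) (j : Fin 8) : (octagonChain k).Adj (i, j) (i, j + 1) :=
  .inl rfl

theorem match_six {i : Fin k} : octagonMatch k (i.castSucc, 6) = (i.succ, 5) := by
  simp [octagonMatch, Fin.castSucc_ne_last]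

theorem match_seven {i : Fin k} : octagonMatch k (i.castSucc, 7) = (i.succ, 0) := by
  simp [octagonMatch, Fin.castSucc_ne_last]

theorem connected_delete (w : Fin (k + 1) × Fin 8) : ((octagonChain k).induce {w}ᶜ).Connected := by
  have step : ∀ {x y : Fin (k + 1) × Fin 8} (hx : x ∈ ({w}ᶜ : Set _)) (hy : y ∈ ({w}ᶜ : Set _)),
      (octagonChain k).Adj x y → ((octagonChain k).induce {w}ᶜ).Reachable ⟨x, hx⟩ ⟨y, hy⟩ :=
    fun _ _ h => SimpleGraph.Adj.reachable (by simpa using h)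
  -- an octagon minus at most one vertex is connected
  have cell : ∀ (i : Fin (k + 1)) (a b : Fin 8) (ha : (i, a) ∈ ({w}ᶜ : Set _))
      (hb : (i, b) ∈ ({w}ᶜ : Set _)),
      ((octagonChain k).induce {w}ᶜ).Reachable ⟨(i, a), ha⟩ ⟨(i, b), hb⟩ := by
    intro i
    -- If `w` lies in another octagon, `c` is still a valid choice. The other seven vertices form a
    -- path starting at `c + 1`; `c` itself, if present, is adjacent to `c + 1`.
    obtain ⟨c, hc⟩ : ∃ c : Fin 8, ∀ j, j ≠ c → (i, j) ∈ ({w}ᶜ : Set _) := by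
      refine ⟨w.2, fun j hj => ?_⟩
      rintro rfl
      exact hj rfl
    have key : ∀ n : ℕ, (hn : n < 7) → (h : (i, c + 1 + n • (1 : Fin 8)) ∈ ({w}ᶜ : Set _)) →
        (h' : (i, c + 1) ∈ ({w}ᶜ : Set _)) →
        ((octagonChain k).induce {w}ᶜ).Reachable ⟨(i, c + 1), h'⟩ ⟨(i, c + 1 + n • (1 : Fin 8)), h⟩ := by
      intro n hn h h'
      induction n with
      | zero => simp
      | succ n ih =>
        have h1 : (i, c + 1 + n • (1 : Fin 8)) ∈ ({w}ᶜ : Set _) := by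
          apply hc
          clear ih h h' hc step
          have hn' : n < 6 := by omega
          interval_cases n <;> revert c <;> decide
        refine (ih (by omega) h1).trans (step _ _ ?_)
        rw [adj_iff]
        left
        simp [add_assoc, succ_nsmul]
    have key' : ∀ a (ha : (i, a) ∈ ({w}ᶜ : Set _)) (h' : (i, c + 1) ∈ ({w}ᶜ : Set _)),
        ((octagonChain k).induce {w}ᶜ).Reachable ⟨(i, c + 1), h'⟩ ⟨(i, a), ha⟩ := by
      intro a ha h'
      by_cases hac : a = c
      · subst hac
        exact (step ha h' (adj_succ i a)).symm
      · have : ∃ n : ℕ, n < 7 ∧ a = c + 1 + n • (1 : Fin 8) := by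
          clear ha h' key hc step
          revert a c; decide
        obtain ⟨n, hn, rfl⟩ := this
        exact key n hn ha h'
    intro a b ha hb
    have h' : (i, c + 1) ∈ ({w}ᶜ : Set _) := hc _ (by simp)
    exact (key' a ha h').symm.trans (key' b hb h')
  have all : ∀ (i : Fin (k + 1)) (a b : Fin 8) (ha : ((0 : Fin (k + 1)), a) ∈ ({w}ᶜ : Set _))
      (hb : (i, b) ∈ ({w}ᶜ : Set _)),
      ((octagonChain k).induce {w}ᶜ).Reachable ⟨(0, a), ha⟩ ⟨(i, b), hb⟩ := by
    intro i
    induction i using Fin.induction with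
    | zero => exact cell 0
    | succ i ih =>
      intro a b ha hb
      -- The two rails are disjoint: if the deleted vertex hits the rail `7 0`, the rail `6 5` is
      -- intact.
      by_cases h : (i.castSucc, (7 : Fin 8)) ∈ ({w}ᶜ : Set _) ∧ (i.succ, (0 : Fin 8)) ∈ ({w}ᶜ : Set _)
      · exact ((ih a _ ha h.1).trans (step h.1 h.2 (.inr (.inr match_seven.symm)))).trans
          (cell _ _ _ h.2 hb)
      · have h6 : (i.castSucc, (6 : Fin 8)) ∈ ({w}ᶜ : Set _) := by
          rintro rfl; simp at h
        have h5 : (i.succ, (5 : Fin 8)) ∈ ({w}ᶜ : Set _) := by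
          rintro rfl; simp at h
        exact ((ih a _ ha h6).trans (step h6 h5 (.inr (.inr match_six.symm)))).trans
          (cell _ _ _ h5 hb)
  obtain ⟨a, ha⟩ : ∃ a, ((0 : Fin (k + 1)), a) ∈ ({w}ᶜ : Set _) := by
    refine ⟨w.2 + 1, fun h => ?_⟩
    simpa using congrArg Prod.snd (Set.mem_singleton_iff.1 h)
  refine (SimpleGraph.connected_iff_exists_forall_reachable _).2 ⟨⟨(0, a), ha⟩, ?_⟩
  rintro ⟨⟨i, b⟩, hb⟩
  exact all i a b ha hb

theorem isTwoConnected : (octagonChain k).IsTwoConnected where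
  two_lt_card := by simp; omega
  connected_delete := connected_delete
  connected := by
    refine (SimpleGraph.connected_iff _).2 ⟨fun x y => ?_, inferInstance⟩
    obtain ⟨w, hw⟩ : ∃ w : Fin (k + 1) × Fin 8, w ∉ ({x, y} : Finset _) := by
      by_contra! h
      have h1 := Finset.card_le_card (fun z _ => h z : Finset.univ ⊆ ({x, y} : Finset _))
      have h2 := Finset.card_le_two (a := x) (b := y)
      simp at h1
      omega
    simp only [Finset.mem_insert, Finset.mem_singleton, not_or] at hw
    exact ((connected_delete w).preconnected ⟨x, Ne.symm hw.1⟩ ⟨y, Ne.symm hw.2⟩).map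
      (SimpleGraph.Embedding.induce _).toHom

end octagonChain

/-! ### Intersections of segments via signed areas -/

/-- Twice the signed area of the triangle `a b c`. -/
def signedArea {R : Type*} [Ring R] (a b c : R × R) : R :=
  (b.1 - a.1) * (c.2 - a.2) - (b.2 - a.2) * (c.1 - a.1)

theorem exists_signedArea_eq {a b c d z : ℝ × ℝ} (hz : z ∈ segment ℝ c d) :
    ∃ s t : ℝ, 0 ≤ s ∧ 0 ≤ t ∧ s + t = 1 ∧ z = s • c + t • d ∧
      signedArea a b z = s * signedArea a b c + t * signedArea a b d := by
  obtain ⟨s, t, hs, ht, hst, rfl⟩ := hz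
  refine ⟨s, t, hs, ht, hst, rfl, ?_⟩
  obtain rfl : s = 1 - t := by linarith
  simp [signedArea]
  ring

theorem signedArea_eq_zero {a b z : ℝ × ℝ} (hz : z ∈ segment ℝ a b) : signedArea a b z = 0 := by
  obtain ⟨s, t, -, -, -, -, h⟩ := exists_signedArea_eq (a := a) (b := b) hz
  rw [h]
  simp only [signedArea]
  ring

/-- The signed area over `a b` is affine in the third point. It vanishes on the segment `a b` and
keeps one strict sign on `c d`. -/
theorem notMem_segment_of_signedArea_mul_pos {a b c d z : ℝ × ℝ}
    (h : 0 < signedArea a b c * signedArea a b d) (hz : z ∈ segment ℝ a b) :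
    z ∉ segment ℝ c d := by
  intro hz'
  obtain ⟨s, t, hs, ht, hst, -, h'⟩ := exists_signedArea_eq (a := a) (b := b) hz'
  rw [signedArea_eq_zero hz] at h'
  rcases pos_and_pos_or_neg_and_neg_of_mul_pos h with ⟨hc, hd⟩ | ⟨hc, hd⟩
  · rcases hs.eq_or_lt with rfl | hs
    · nlinarith
    · nlinarith [mul_pos hs hc, mul_nonneg ht hd.le]
  · rcases hs.eq_or_lt with rfl | hs
    · nlinarith
    · nlinarith [mul_neg_of_pos_of_neg hs hc, mul_nonpos_of_nonneg_of_nonpos ht hd.le]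

theorem eq_left_of_signedArea_ne_zero {a b d z : ℝ × ℝ} (h : signedArea a b d ≠ 0)
    (hz : z ∈ segment ℝ a b) (hz' : z ∈ segment ℝ a d) : z = a := by
  obtain ⟨s, t, -, -, hst, rfl, h'⟩ := exists_signedArea_eq (a := a) (b := b) hz'
  have h0 : signedArea a b a = 0 := by simp [signedArea]
  rw [signedArea_eq_zero hz, h0, mul_zero, zero_add] at h'
  have ht : t = 0 := by simpa [h] using h'.symm
  obtain rfl : s = 1 := by linarith
  simp [ht]

/-- A criterion under which the segments `p a, p b` and `p c, p d` meet only in common ends. -/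
def SegmentsApart {ι R : Type*} [Ring R] [LinearOrder R] (p : ι → R × R) (a b c d : ι) : Prop :=
  (a = c ∧ signedArea (p a) (p b) (p d) ≠ 0) ∨ (a = d ∧ signedArea (p a) (p b) (p c) ≠ 0) ∨
  (b = c ∧ signedArea (p b) (p a) (p d) ≠ 0) ∨ (b = d ∧ signedArea (p b) (p a) (p c) ≠ 0) ∨
  0 < signedArea (p a) (p b) (p c) * signedArea (p a) (p b) (p d) ∨
  0 < signedArea (p c) (p d) (p a) * signedArea (p c) (p d) (p b)

theorem SegmentsApart.exists_eq {ι : Type*} {p : ι → ℝ × ℝ} {a b c d : ι}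
    (h : SegmentsApart p a b c d) {z : ℝ × ℝ} (hz : z ∈ segment ℝ (p a) (p b))
    (hz' : z ∈ segment ℝ (p c) (p d)) : ∃ j, (j = a ∨ j = b) ∧ (j = c ∨ j = d) ∧ z = p j := by
  rcases h with ⟨rfl, h⟩ | ⟨rfl, h⟩ | ⟨rfl, h⟩ | ⟨rfl, h⟩ | h | h
  · exact ⟨a, by simp, by simp, eq_left_of_signedArea_ne_zero h hz hz'⟩
  · exact ⟨a, by simp, by simp,
      eq_left_of_signedArea_ne_zero h hz (by rwa [segment_symm])⟩
  · exact ⟨b, by simp, by simp,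
      eq_left_of_signedArea_ne_zero h (by rwa [segment_symm]) hz'⟩
  · exact ⟨b, by simp, by simp,
      eq_left_of_signedArea_ne_zero h (by rwa [segment_symm]) (by rwa [segment_symm])⟩
  · exact absurd hz' (notMem_segment_of_signedArea_mul_pos h hz)
  · exact absurd hz (notMem_segment_of_signedArea_mul_pos h hz')

/-! ### Straight-line drawing and planarity -/

namespace octagonChain

/-- Positions of the vertices of an octagon (`0` to `7`) and of the two vertices of the next
octagon that are matched to it (`8` and `9`). -/
def blockPos : Fin 10 → ℤ × ℤ :=
  ![(0, 4), (2, 2), (3, 0), (1, 0), (2, -2), (0, -4), (6, -5), (6, 5), (8, 4), (8, -4)]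

/-- All edges that may occur in a block of the drawing. -/
def blockEdges : List (Fin 10 × Fin 10) :=
  [(0, 1), (1, 2), (2, 3), (3, 4), (4, 5), (5, 6), (6, 7), (7, 0), (1, 3), (2, 4), (2, 7), (4, 6),
    (0, 5), (7, 8), (6, 9)]

/-- The position of the point `j` in the block with number `i`. -/
def chainPos (i : ℕ) (j : Fin 10) : ℝ × ℝ :=
  (8 * i + ((blockPos j).1 : ℝ), ((blockPos j).2 : ℝ))

/-- The list also holds chords that belong only to the first or the last octagon, so a single
integer computation serves all blocks. -/
theorem segmentsApart_blockPos : ∀ e ∈ blockEdges, ∀ f ∈ blockEdges, e ≠ f →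
    SegmentsApart blockPos e.1 e.2 f.1 f.2 := by
  unfold SegmentsApart signedArea
  decide +kernel

/-- The shift by `8 * i` cancels in differences, which carries the integer check over to every real
block. -/
theorem signedArea_chainPos (i : ℕ) (a b c : Fin 10) :
    signedArea (chainPos i a) (chainPos i b) (chainPos i c) =
      (signedArea (blockPos a) (blockPos b) (blockPos c) : ℤ) := by
  simp [signedArea, chainPos]

theorem exists_eq_of_mem_block {i : ℕ} {e f : Fin 10 × Fin 10} (he : e ∈ blockEdges)
    (hf : f ∈ blockEdges) (hef : e ≠ f) {z : ℝ × ℝ}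
    (hz : z ∈ segment ℝ (chainPos i e.1) (chainPos i e.2))
    (hz' : z ∈ segment ℝ (chainPos i f.1) (chainPos i f.2)) :
    ∃ j, (j = e.1 ∨ j = e.2) ∧ (j = f.1 ∨ j = f.2) ∧ z = chainPos i j := by
  refine SegmentsApart.exists_eq ?_ hz hz'
  simpa only [SegmentsApart, signedArea_chainPos, ← Int.cast_mul, Int.cast_pos, ne_eq,
    Int.cast_eq_zero] using segmentsApart_blockPos e he f hf hef

theorem chainPos_fst_nonneg (i : ℕ) (j : Fin 10) : 8 * (i : ℝ) ≤ (chainPos i j).1 := by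
  have : 0 ≤ (blockPos j).1 := by revert j; decide
  have : (0 : ℝ) ≤ ((blockPos j).1 : ℝ) := by exact_mod_cast this
  simp only [chainPos]; linarith

theorem chainPos_fst_le (i : ℕ) (j : Fin 10) : (chainPos i j).1 ≤ 8 * (i : ℝ) + 8 := by
  have : (blockPos j).1 ≤ 8 := by revert j; decide
  have : ((blockPos j).1 : ℝ) ≤ 8 := by exact_mod_cast this
  simp only [chainPos]; linarith

theorem chainPos_succ (i : ℕ) : chainPos (i + 1) 0 = chainPos i 8 ∧
    chainPos (i + 1) 5 = chainPos i 9 := by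
  constructor <;> simp [chainPos, blockPos] <;> ring

theorem fst_mem_of_mem_block {i : ℕ} {a b : Fin 10} {z : ℝ × ℝ}
    (hz : z ∈ segment ℝ (chainPos i a) (chainPos i b)) :
    8 * (i : ℝ) ≤ z.1 ∧ z.1 ≤ 8 * i + 8 := by
  obtain ⟨s, t, hs, ht, hst, rfl⟩ := hz
  have h1 := chainPos_fst_nonneg i a
  have h2 := chainPos_fst_nonneg i b
  have h3 := chainPos_fst_le i a
  have h4 := chainPos_fst_le i b
  obtain rfl : s = 1 - t := by linarith
  simp only [Prod.fst_add, Prod.smul_fst, smul_eq_mul]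
  constructor <;> nlinarith

/-- On the right border of a block there are only the two points of the next block. -/
theorem eq_of_fst_eq_right {i : ℕ} {e : Fin 10 × Fin 10} (he : e ∈ blockEdges) {z : ℝ × ℝ}
    (hz : z ∈ segment ℝ (chainPos i e.1) (chainPos i e.2)) (h : z.1 = 8 * i + 8) :
    (e.2 = 8 ∨ e.2 = 9) ∧ z = chainPos i e.2 := by
  have h1 : (blockPos e.1).1 ≤ 6 := by clear hz; revert e; decide
  have h2 : (e.2 = 8 ∨ e.2 = 9) ∨ (blockPos e.2).1 ≤ 6 := by clear hz; revert e; decide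
  have h1' : ((blockPos e.1).1 : ℝ) ≤ 6 := by exact_mod_cast h1
  obtain ⟨s, t, hs, ht, hst, rfl⟩ := hz
  obtain rfl : s = 1 - t := by linarith
  simp only [Prod.fst_add, Prod.smul_fst, smul_eq_mul, chainPos] at h
  have h3 : ((blockPos e.2).1 : ℝ) ≤ 8 := by
    have := chainPos_fst_le i e.2
    simp only [chainPos] at this
    linarith
  rcases h2 with h2 | h2
  · refine ⟨h2, ?_⟩
    obtain rfl : t = 1 := by nlinarith
    simp
  · have h2' : ((blockPos e.2).1 : ℝ) ≤ 6 := by exact_mod_cast h2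
    nlinarith

theorem blockPos_injective : Function.Injective blockPos := by decide

theorem chainPos_injective (i : ℕ) : Function.Injective (chainPos i) := by
  intro a b h
  apply blockPos_injective
  simp only [chainPos, Prod.mk.injEq, add_right_inj, Int.cast_inj] at h
  exact Prod.ext h.1 h.2

/-- The point is an end of some block edge `g`; if it also lies on `e ≠ g`, it must be a common end
of the two. -/
theorem eq_of_chainPos_mem {i : ℕ} {e : Fin 10 × Fin 10} (he : e ∈ blockEdges) {c : Fin 10}
    (hc : c = 0 ∨ c = 5) (hz : chainPos i c ∈ segment ℝ (chainPos i e.1) (chainPos i e.2)) :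
    c = e.1 ∨ c = e.2 := by
  obtain ⟨g, hg, hgc⟩ : ∃ g ∈ blockEdges, c = g.1 ∨ c = g.2 := by
    rcases hc with rfl | rfl
    · exact ⟨(0, 1), by decide, by decide⟩
    · exact ⟨(4, 5), by decide, by decide⟩
  by_cases h : g = e
  · exact h ▸ hgc
  obtain ⟨j, -, hj, hzj⟩ := exists_eq_of_mem_block hg he h
    (by rcases hgc with rfl | rfl
        exacts [left_mem_segment ℝ _ _, right_mem_segment ℝ _ _]) hz
  rwa [chainPos_injective i hzj]

variable {k : ℕ}

/-- The straight-line drawing of the chain. -/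
def drawing (k : ℕ) (x : Fin (k + 1) × Fin 8) : ℝ × ℝ :=
  chainPos x.1 (x.2.castLE (by norm_num))

theorem drawing_injective : Function.Injective (drawing k) := by
  rintro ⟨i, a⟩ ⟨i', b⟩ h
  have key : ∀ c : Fin 8, 0 ≤ (blockPos (c.castLE (by norm_num))).1 ∧
      (blockPos (c.castLE (by norm_num))).1 < 8 := by decide
  have h1 : 8 * (i : ℤ) + (blockPos (a.castLE (by norm_num))).1 =
      8 * (i' : ℤ) + (blockPos (b.castLE (by norm_num))).1 := by
    have := congrArg Prod.fst h
    simp only [drawing, chainPos] at this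
    exact_mod_cast this
  have ha := key a
  have hb := key b
  obtain rfl : i = i' := Fin.ext (by omega)
  simpa using chainPos_injective i h

theorem exists_blockEdge {x y : Fin (k + 1) × Fin 8} (h : (octagonChain k).Adj x y) :
    ∃ (i : ℕ) (f : Fin 10 × Fin 10) (x' y' : Fin (k + 1) × Fin 8), f ∈ blockEdges ∧
      s(x, y) = s(x', y') ∧ drawing k x' = chainPos i f.1 ∧ drawing k y' = chainPos i f.2 := by
  have cyc : ∀ j : Fin 8, ((j.castLE (by norm_num) : Fin 10), ((j + 1).castLE (by norm_num) : Fin 10))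
      ∈ blockEdges := by decide
  have top : ∀ (i : Fin (k + 1)), i ≠ Fin.last k →
      drawing k (i + 1, 0) = chainPos i 8 ∧ drawing k (i + 1, 5) = chainPos i 9 := by
    intro i hi
    have hv : ((i + 1 : Fin (k + 1)) : ℕ) = i + 1 :=
      Fin.val_add_one_of_lt (Fin.lt_last_iff_ne_last.2 hi)
    simp only [drawing, hv]
    exact chainPos_succ i
  obtain ⟨i, j⟩ := x
  rcases h with rfl | rfl | rfl
  · exact ⟨i, _, (i, j), (i, j + 1), cyc j, rfl, rfl, rfl⟩
  · exact ⟨i, _, (i, j - 1), (i, j), cyc (j - 1), Sym2.eq_swap, rfl, by simp [drawing]⟩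
  · fin_cases j <;> simp only [octagonMatch] <;> (try split_ifs with h0)
    · exact ⟨i, (0, 5), (i, 0), (i, 5), by decide, rfl, rfl, rfl⟩
    · refine ⟨(i - 1 : Fin (k + 1)), (7, 8), (i - 1, 7), (i, 0), by decide, Sym2.eq_swap, rfl, ?_⟩
      simpa using (top (i - 1) (sub_one_ne_last_of_ne_zero h0)).1
    · exact ⟨i, (1, 3), (i, 1), (i, 3), by decide, rfl, rfl, rfl⟩
    · exact ⟨i, (2, 7), (i, 2), (i, 7), by decide, rfl, rfl, rfl⟩
    · exact ⟨i, (2, 4), (i, 2), (i, 4), by decide, rfl, rfl, rfl⟩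
    · exact ⟨i, (1, 3), (i, 1), (i, 3), by decide, Sym2.eq_swap, rfl, rfl⟩
    · exact ⟨i, (4, 6), (i, 4), (i, 6), by decide, rfl, rfl, rfl⟩
    · exact ⟨i, (2, 4), (i, 2), (i, 4), by decide, Sym2.eq_swap, rfl, rfl⟩
    · exact ⟨i, (0, 5), (i, 0), (i, 5), by decide, Sym2.eq_swap, rfl, rfl⟩
    · refine ⟨(i - 1 : Fin (k + 1)), (6, 9), (i - 1, 6), (i, 5), by decide, Sym2.eq_swap, rfl, ?_⟩
      simpa using (top (i - 1) (sub_one_ne_last_of_ne_zero h0)).2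
    · exact ⟨i, (4, 6), (i, 4), (i, 6), by decide, Sym2.eq_swap, rfl, rfl⟩
    · exact ⟨i, (6, 9), (i, 6), (i + 1, 5), by decide, rfl, rfl, (top i h0).2⟩
    · exact ⟨i, (2, 7), (i, 2), (i, 7), by decide, Sym2.eq_swap, rfl, rfl⟩
    · exact ⟨i, (7, 8), (i, 7), (i + 1, 0), by decide, rfl, rfl, (top i h0).1⟩

/-- The segment that represents an edge in the drawing. -/
def drawnEdge (k : ℕ) : Sym2 (Fin (k + 1) × Fin 8) → Set (ℝ × ℝ) :=
  Sym2.lift ⟨fun x y => segment ℝ (drawing k x) (drawing k y), fun _ _ => segment_symm _ _ _⟩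

theorem drawnEdge_mk (x y : Fin (k + 1) × Fin 8) :
    drawnEdge k s(x, y) = segment ℝ (drawing k x) (drawing k y) := rfl

/-- Segments of different blocks lie in different strips of width 8, so they meet only if the strips
are adjacent, and then on the common border line. There the left block has only its points `8` and
`9`, which are `0` and `5` of the right block. -/
theorem exists_common_end_of_le {i i' : ℕ} {f f' : Fin 10 × Fin 10}
    {x y x' y' : Fin (k + 1) × Fin 8} (hf : f ∈ blockEdges) (hf' : f' ∈ blockEdges)
    (hx : drawing k x = chainPos i f.1) (hy : drawing k y = chainPos i f.2)
    (hx' : drawing k x' = chainPos i' f'.1) (hy' : drawing k y' = chainPos i' f'.2)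
    (hne : s(x, y) ≠ s(x', y')) (hi : i ≤ i') {z : ℝ × ℝ} (hz : z ∈ drawnEdge k s(x, y))
    (hz' : z ∈ drawnEdge k s(x', y')) : ∃ v, v ∈ s(x, y) ∧ v ∈ s(x', y') ∧ z = drawing k v := by
  rw [drawnEdge_mk, hx, hy] at hz
  rw [drawnEdge_mk, hx', hy'] at hz'
  have conclude : ∀ c, (c = f.1 ∨ c = f.2) → ∀ c', (c' = f'.1 ∨ c' = f'.2) → z = chainPos i c →
      z = chainPos i' c' → ∃ v, v ∈ s(x, y) ∧ v ∈ s(x', y') ∧ z = drawing k v := by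
    intro c hc c' hc' hzc hzc'
    obtain ⟨v, hv, hzv⟩ : ∃ v ∈ s(x, y), z = drawing k v := by
      rcases hc with rfl | rfl
      · exact ⟨x, Sym2.mem_mk_left _ _, hzc.trans hx.symm⟩
      · exact ⟨y, Sym2.mem_mk_right _ _, hzc.trans hy.symm⟩
    obtain ⟨v', hv', hzv'⟩ : ∃ v ∈ s(x', y'), z = drawing k v := by
      rcases hc' with rfl | rfl
      · exact ⟨x', Sym2.mem_mk_left _ _, hzc'.trans hx'.symm⟩
      · exact ⟨y', Sym2.mem_mk_right _ _, hzc'.trans hy'.symm⟩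
    obtain rfl := drawing_injective (hzv.symm.trans hzv')
    exact ⟨v, hv, hv', hzv⟩
  rcases hi.eq_or_lt with rfl | hi
  · have hff : f ≠ f' := by
      rintro rfl
      obtain rfl := drawing_injective (hx.trans hx'.symm)
      obtain rfl := drawing_injective (hy.trans hy'.symm)
      exact hne rfl
    obtain ⟨c, hc, hc', hzc⟩ := exists_eq_of_mem_block hf hf' hff hz hz'
    exact conclude c hc c hc' hzc hzc
  · have h1 := (fst_mem_of_mem_block hz).2
    have h2 := (fst_mem_of_mem_block hz').1
    have h3 : (i : ℝ) + 1 ≤ i' := by exact_mod_cast hi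
    obtain rfl : i' = i + 1 := by
      have : (i' : ℝ) ≤ i + 1 := by linarith
      have : i' ≤ i + 1 := by exact_mod_cast this
      omega
    obtain ⟨h8, hz8⟩ := eq_of_fst_eq_right hf hz (by push_cast at h2; linarith)
    obtain ⟨c, hc, hzc⟩ : ∃ c : Fin 10, (c = 0 ∨ c = 5) ∧ z = chainPos (i + 1) c := by
      rcases h8 with h8 | h8 <;> rw [h8] at hz8
      · exact ⟨0, .inl rfl, hz8.trans (chainPos_succ i).1.symm⟩
      · exact ⟨5, .inr rfl, hz8.trans (chainPos_succ i).2.symm⟩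
    exact conclude _ (.inr rfl) c (eq_of_chainPos_mem hf' hc (hzc ▸ hz')) hz8 hzc

theorem exists_common_end {e e' : Sym2 (Fin (k + 1) × Fin 8)} (he : e ∈ (octagonChain k).edgeSet)
    (he' : e' ∈ (octagonChain k).edgeSet) (hne : e ≠ e') {z : ℝ × ℝ} (hz : z ∈ drawnEdge k e)
    (hz' : z ∈ drawnEdge k e') : ∃ v, v ∈ e ∧ v ∈ e' ∧ z = drawing k v := by
  induction e with | _ x y
  induction e' with | _ x' y'
  obtain ⟨i, f, x, y, hf, h, hx, hy⟩ := exists_blockEdge he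
  obtain ⟨i', f', x', y', hf', h', hx', hy'⟩ := exists_blockEdge he'
  rw [h] at hz hne ⊢
  rw [h'] at hz' hne ⊢
  rcases le_total i i' with hi | hi
  · exact exists_common_end_of_le hf hf' hx hy hx' hy' hne hi hz hz'
  · obtain ⟨v, hv, hv', hzv⟩ :=
      exists_common_end_of_le hf' hf hx' hy' hx hy hne.symm hi hz' hz
    exact ⟨v, hv', hv, hzv⟩

theorem isPlanar : (octagonChain k).IsPlanar := by
  refine ⟨drawing k, drawnEdge k, drawing_injective, fun x y hxy => ?_, fun e he v hv => ?_,
    fun e he f hf hne z hz => exists_common_end he hf hne hz.1 hz.2⟩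
  · exact ⟨Path.segment _ _, Path.segment_injective_of_ne (drawing_injective.ne hxy.ne),
      Path.range_segment _ _⟩
  · by_contra hve
    -- Every vertex is an end of some edge, so a vertex on a foreign arc would be a common end of
    -- two edges.
    have hf : s(v, (v.1, v.2 + 1)) ∈ (octagonChain k).edgeSet := adj_succ v.1 v.2
    obtain ⟨u, hu, -, huv⟩ := exists_common_end he hf
      (fun h => hve (h ▸ Sym2.mem_mk_left _ _)) hv (left_mem_segment ℝ _ _)
    exact hve (drawing_injective huv ▸ hu)

end octagonChain

/-! ### Edge multiplicities of closed walks: parity and cuts -/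

namespace SimpleGraph

variable {V : Type*} [DecidableEq V] {G : SimpleGraph V}

theorem sum_count_neighborFinset [Fintype V] [DecidableRel G.Adj] (x : V) {l : List (Sym2 V)} (hl : ∀ e ∈ l, e ∈ G.edgeSet) :
    ∑ y ∈ G.neighborFinset x, l.count s(x, y) = l.countP (x ∈ ·) := by
  induction l with
  | nil => simp
  | cons e l ih =>
    simp only [List.count_cons, List.countP_cons, Finset.sum_add_distrib]
    rw [ih fun e he => hl e (List.mem_cons_of_mem _ he)]
    congr 1
    have he := hl e List.mem_cons_self
    by_cases hx : x ∈ e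
    · obtain ⟨z, rfl⟩ := hx
      have hz : z ∈ G.neighborFinset x := by simpa using he
      have hxz : ∀ y, s(x, z) = s(x, y) ↔ z = y := fun y => Sym2.congr_right
      simp only [beq_iff_eq, hxz]
      simpa using he
    · have : ∀ y, e ≠ s(x, y) := fun y h => hx (h ▸ Sym2.mem_mk_left _ _)
      simp [hx, this]

theorem sum_countP_mem [Fintype V] {l : List (Sym2 V)} (hl : ∀ e ∈ l, e ∈ G.edgeSet) :
    ∑ x, l.countP (x ∈ ·) = 2 * l.length := by
  induction l with
  | nil => simp
  | cons e l ih =>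
    simp only [List.countP_cons, Finset.sum_add_distrib, List.length_cons]
    rw [ih fun e he => hl e (List.mem_cons_of_mem _ he), mul_add]
    congr 1
    have he := hl e List.mem_cons_self
    induction e with | _ a b
    have hab : a ≠ b := G.ne_of_adj he
    simp only [Sym2.mem_iff, decide_eq_true_eq, Finset.sum_boole]
    rw [show ({x | x = a ∨ x = b} : Finset V) = {a, b} by ext; simp, Finset.card_pair hab]
    rfl

namespace Walk

/-- The induction passes through open walks, whose parity defect sits at the two ends; for a closed
walk the two indicators cancel mod 2. -/
theorem even_countP_mem_edges {u v : V} (w : G.Walk u v) (x : V) :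
    Even (w.edges.countP (x ∈ ·) + ((if x = u then 1 else 0) + (if x = v then 1 else 0))) := by
  induction w with
  | nil => simp
  | @cons u a v h w ih =>
    have hne : u ≠ a := h.ne
    simp only [edges_cons, List.countP_cons, Sym2.mem_iff, decide_eq_true_eq]
    by_cases h1 : x = u
    · have h2 : x ≠ a := h1 ▸ hne
      simp only [h1.symm, h2, if_true, if_false, true_or, Nat.even_iff] at ih ⊢
      omega
    · by_cases h2 : x = a
      · have h3 : u ≠ x := fun h => h1 h.symm
        simp only [h1, h2.symm, if_true, if_false, or_true, Nat.even_iff] at ih ⊢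
        omega
      · simp only [h1, h2, if_false, or_false, Nat.even_iff] at ih ⊢
        simpa using ih

theorem even_sum_count_edges [Fintype V] [DecidableRel G.Adj] {u : V} (w : G.Walk u u) (x : V) :
    Even (∑ y ∈ G.neighborFinset x, w.edges.count s(x, y)) := by
  rw [sum_count_neighborFinset x fun e he => w.edges_subset_edgeSet he]
  have := w.even_countP_mem_edges x
  rw [Nat.even_add] at this
  exact this.2 (Even.add_self _)

theorem sum_sum_count_edges [Fintype V] [DecidableRel G.Adj] {u v : V} (w : G.Walk u v) :
    ∑ x, ∑ y ∈ G.neighborFinset x, w.edges.count s(x, y) = 2 * w.length := by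
  have h : ∀ e ∈ w.edges, e ∈ G.edgeSet := fun e he => w.edges_subset_edgeSet he
  simp only [sum_count_neighborFinset _ h]
  rw [sum_countP_mem h, length_edges]

theorem IsTSPTour.exists_crossing {u : V} {w : G.Walk u u} (hw : w.IsTSPTour) (S : Set V)
    {a b : V} (ha : a ∈ S) (hb : b ∉ S) :
    ∃ x ∈ S, ∃ y ∉ S, G.Adj x y ∧ 0 < w.edges.count s(x, y) := by
  by_cases hu : u ∈ S
  · obtain ⟨d, hd, h1, h2⟩ := (w.takeUntil b (hw b)).exists_boundary_dart S hu hb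
    refine ⟨_, h1, _, h2, d.adj, List.count_pos_iff.2 ?_⟩
    exact w.edges_takeUntil_subset_edges (hw b) (List.mem_map_of_mem hd)
  · obtain ⟨d, hd, h1, h2⟩ := (w.takeUntil a (hw a)).exists_boundary_dart Sᶜ hu (by simpa)
    refine ⟨_, not_not.1 h2, _, h1, d.adj.symm, List.count_pos_iff.2 ?_⟩
    rw [Sym2.eq_swap]
    exact w.edges_takeUntil_subset_edges (hw a) (List.mem_map_of_mem hd)

end Walk

end SimpleGraph

/-! ### Telescoping and the cost of one block -/

/-- If increments are at least `c` plus the increment of a potential, so is their sum. -/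
theorem mul_add_sub_le_sum_of_potential (c : ℤ) : ∀ (k : ℕ) (T : Fin k → ℤ) (F : Fin (k + 1) → ℤ),
    (∀ i, c + F i.succ - F i.castSucc ≤ T i) → c * k + F (Fin.last k) - F 0 ≤ ∑ i, T i
  | 0, T, F, _ => by simp
  | k + 1, T, F, h => by
    have ih := mul_add_sub_le_sum_of_potential c k (fun i => T i.castSucc) (fun i => F i.castSucc)
      fun i => h i.castSucc
    have hl := h (Fin.last k)
    rw [Fin.sum_univ_castSucc]
    simp only [Fin.succ_last, Fin.castSucc_zero] at hl ih
    push_cast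
    linarith

/-- Here `t, b` are the incoming rails at `0, 5` and `t', b'` the outgoing ones at `7, 6`. Degrees
count inner edges twice and rails once; the terms `t + b` and `t' + b'` rebalance this so that,
after halving, each block pays for its inner edges and its outgoing rails in full. -/
theorem block_inequality {t b x01 x12 x23 x34 x45 x56 x67 x70 x13 x24 t' b' : ℕ}
    (hin : Even (t + b)) (d0 : Even (x01 + x70 + t)) (d1 : Even (x01 + x12 + x13))
    (d2 : Even (x12 + x23 + x24)) (d3 : Even (x23 + x34 + x13)) (d4 : Even (x34 + x45 + x24))
    (d5 : Even (x45 + x56 + b)) (d6 : Even (x56 + x67 + b')) (d7 : Even (x67 + x70 + t'))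
    (p1 : 0 < x01 + x12 + x13) (p2 : 0 < x12 + x23 + x24) (p3 : 0 < x23 + x34 + x13)
    (p4 : 0 < x34 + x45 + x24) (c1234 : 0 < x01 + x45) (c234 : 0 < x12 + x13 + x45)
    (c123 : 0 < x01 + x34 + x24) (cl : 0 < x70 + x56) (co : 0 < t' + b')
    (c7 : 0 < x56 + x67 + t') (c6 : 0 < x70 + x67 + b')
    (p6 : 0 < x56 + x67 + b') (p7 : 0 < x67 + x70 + t') :
    20 + 2 * ((t' + 1) % 2) + (t + b) ≤ (x01 + x70 + t) + (x01 + x12 + x13) + (x12 + x23 + x24) +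
      (x23 + x34 + x13) + (x34 + x45 + x24) + (x45 + x56 + b) + (x56 + x67 + b') +
      (x67 + x70 + t') + 2 * ((t + 1) % 2) + (t' + b') := by
  simp only [Nat.even_iff] at *
  -- `D` is the cost of the diamond rung. Crossing it an odd number of times takes at least a path
  -- of 5 edges; an even number takes at least 6, for instance a 4-cycle plus a doubled link.
  obtain ⟨D, hD⟩ : ∃ D, D = x01 + x45 + (x12 + x23 + x34 + x13 + x24) := ⟨_, rfl⟩
  have hodd : 5 ≤ D := by omega
  have heven : x01 % 2 = 0 → 6 ≤ D := by
    intro h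
    by_cases h0 : x45 = 0
    · omega
    · by_cases h1 : x01 = 0 <;> omega
  have h01 : x01 % 2 = x45 % 2 := by omega
  have cl2 : 2 ≤ x70 + x56 := by omega
  have co2 : 2 ≤ t' + b' := by omega
  suffices 10 + (t' + 1) % 2 ≤ D + x56 + x67 + x70 + t' + b' + (t + 1) % 2 by omega
  clear d1 d2 d3 d4 p1 p2 p3 p4 c1234 c234 c123 hD
  -- By parity at `0` and `7`, `x67 ≡ x01 + t + t'` mod 2, so these three parities decide whether
  -- the plain rung must be used.
  rcases Nat.mod_two_eq_zero_or_one x01 with h | h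
  · have := heven h
    rcases Nat.mod_two_eq_zero_or_one t with ht | ht <;>
    rcases Nat.mod_two_eq_zero_or_one t' with ht' | ht'
    · omega
    · have : 0 < x67 := by omega
      omega
    · have : 0 < x67 := by omega
      omega
    · omega
  · rcases Nat.mod_two_eq_zero_or_one t with ht | ht <;>
    rcases Nat.mod_two_eq_zero_or_one t' with ht' | ht'
    · have : 0 < x67 := by omega
      omega
    · omega
    -- The tight case: `D` may be 5, so the remaining five even multiplicities must total 6. If the
    -- plain rung is unused, the cuts around `6` and `7` force both of `x70, x56` or both of `t',
    -- b'` to be at least 2.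
    · have h67 : x67 % 2 = 0 := by omega
      have h56 : x56 % 2 = 0 := by omega
      have h70 : x70 % 2 = 0 := by omega
      rcases Nat.eq_zero_or_pos x67 with h0 | h0
      · have : 2 ≤ x56 + t' := by omega
        have : 2 ≤ x70 + b' := by omega
        have : 2 ≤ x70 + t' := by omega
        have : 2 ≤ x56 + b' := by omega
        rcases Nat.eq_zero_or_pos x70 with h1 | h1 <;> rcases Nat.eq_zero_or_pos x56 with h2 | h2 <;>
          omega
      · omega
    · have : 0 < x67 := by omega
      omega

/-! ### The lower bound for tours of the chain -/

namespace octagonChain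

variable {k : ℕ}

theorem match_two {i : Fin k} : octagonMatch k (i.castSucc, 2) = (i.castSucc, 4) := by
  simp [octagonMatch, Fin.castSucc_ne_last]

theorem match_four {i : Fin k} : octagonMatch k (i.castSucc, 4) = (i.castSucc, 2) := by
  simp [octagonMatch, Fin.castSucc_ne_last]

theorem match_succ_zero {i : Fin k} : octagonMatch k (i.succ, 0) = (i.castSucc, 7) := by
  rw [← match_seven, octagonMatch_involutive]

theorem match_succ_five {i : Fin k} : octagonMatch k (i.succ, 5) = (i.castSucc, 6) := by
  rw [← match_six, octagonMatch_involutive]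

theorem fst_octagonMatch_le (i : Fin (k + 1)) {j : Fin 8} (h6 : j ≠ 6) (h7 : j ≠ 7) :
    (octagonMatch k (i, j)).1 ≤ i := by
  have hs : i ≠ 0 → i - 1 ≤ i := fun h => by
    rw [Fin.le_def, Fin.val_sub_one_of_ne_zero h]; omega
  fin_cases j <;> simp only [octagonMatch] <;> (try split_ifs with h) <;>
    first
    | exact le_rfl
    | exact hs h
    | exact absurd rfl h6
    | exact absurd rfl h7

theorem octagonMatch_zero_five (i : Fin (k + 1)) {j : Fin 8} (hj : j = 0 ∨ j = 5) :
    (octagonMatch k (i, j)).1 < i ∨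
      (octagonMatch k (i, j)).1 = i ∧
        ((octagonMatch k (i, j)).2 = 0 ∨ (octagonMatch k (i, j)).2 = 5) := by
  have hs : i ≠ 0 → i - 1 < i := fun h => by
    have := Fin.val_ne_zero_iff.2 h
    rw [Fin.lt_def, Fin.val_sub_one_of_ne_zero h]; omega
  rcases hj with rfl | rfl <;> simp only [octagonMatch] <;> split_ifs with h <;> simp [hs, h]

/-- The degree of a vertex with respect to given edge multiplicities. -/
def weightedDegree (m : Fin (k + 1) × Fin 8 → Fin (k + 1) × Fin 8 → ℕ)
    (x : Fin (k + 1) × Fin 8) : ℕ :=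
  m x (x.1, x.2 + 1) + (m x (x.1, x.2 - 1) + m x (octagonMatch k x))

/-- Edge multiplicities on the chain that behave like those of a closed walk through all vertices:
degrees are even, and every cut is crossed. -/
structure IsTourWeight (m : Fin (k + 1) × Fin 8 → Fin (k + 1) × Fin 8 → ℕ) : Prop where
  symm : ∀ x y, m x y = m y x
  even : ∀ x, Even (weightedDegree m x)
  crossing : ∀ (S : Set (Fin (k + 1) × Fin 8)) (a b), a ∈ S → b ∉ S →
    ∃ x ∈ S, ∃ y ∉ S, (octagonChain k).Adj x y ∧ 0 < m x y

namespace IsTourWeight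

variable {m : Fin (k + 1) × Fin 8 → Fin (k + 1) × Fin 8 → ℕ}

theorem exists_crossing_cell (h : IsTourWeight m) (i : Fin (k + 1)) (A : Finset (Fin 8))
    (hA : A.Nonempty) (hA' : A ≠ Finset.univ) :
    ∃ j ∈ A, (j + 1 ∉ A ∧ 0 < m (i, j) (i, j + 1)) ∨ (j - 1 ∉ A ∧ 0 < m (i, j) (i, j - 1)) ∨
      (((octagonMatch k (i, j)).1 = i → (octagonMatch k (i, j)).2 ∉ A) ∧
        0 < m (i, j) (octagonMatch k (i, j))) := by
  obtain ⟨a, ha⟩ := hA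
  obtain ⟨b, hb⟩ : ∃ b, b ∉ A := by
    by_contra! hall
    exact hA' (Finset.eq_univ_iff_forall.2 hall)
  obtain ⟨⟨i', j⟩, ⟨rfl, hj⟩, y, hy, hadj, hpos⟩ :=
    h.crossing {x | x.1 = i ∧ x.2 ∈ A} (i, a) (i, b) ⟨rfl, ha⟩ fun h => hb h.2
  refine ⟨j, hj, ?_⟩
  rcases hadj with rfl | rfl | rfl
  · exact .inl ⟨fun h => hy ⟨rfl, h⟩, hpos⟩
  · exact .inr (.inl ⟨fun h => hy ⟨rfl, h⟩, hpos⟩)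
  · exact .inr (.inr ⟨fun h h' => hy ⟨h, h'⟩, hpos⟩)

/-- The cut is taken around all earlier octagons together with `A`. Since `0` and `5` lie in `A`,
the incoming rails, or the chord `0 5` of the first octagon, stay on one side and cannot be the
crossing edge. -/
theorem exists_crossing_left (h : IsTourWeight m) (i : Fin k) (A : Finset (Fin 8))
    (h0 : 0 ∈ A) (h5 : 5 ∈ A) :
    ∃ j ∈ A, (j + 1 ∉ A ∧ 0 < m (i.castSucc, j) (i.castSucc, j + 1)) ∨
      (j - 1 ∉ A ∧ 0 < m (i.castSucc, j) (i.castSucc, j - 1)) ∨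
      (((octagonMatch k (i.castSucc, j)).1 = i.castSucc →
          (octagonMatch k (i.castSucc, j)).2 ∉ A) ∧ j ≠ 0 ∧ j ≠ 5 ∧
        0 < m (i.castSucc, j) (octagonMatch k (i.castSucc, j))) := by
  obtain ⟨⟨i', j⟩, hx, y, hy, hadj, hpos⟩ :=
    h.crossing {x | x.1 < i.castSucc ∨ x.1 = i.castSucc ∧ x.2 ∈ A} (i.castSucc, 0) (i.succ, 0)
      (.inr ⟨rfl, h0⟩) (by simp [Fin.le_def, Fin.ext_iff])
  simp only [Set.mem_ofPred_eq, not_or, not_and, not_lt] at hx hy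
  rcases hx with hx | ⟨rfl, hj⟩
  · exfalso
    rcases hadj with rfl | rfl | rfl
    · exact absurd hx hy.1.not_gt
    · exact absurd hx hy.1.not_gt
    · have hi' : i' ≠ Fin.last k := (hx.trans_le (Fin.le_last _)).ne
      obtain ⟨i', rfl⟩ := Fin.exists_castSucc_eq.2 hi'
      have hle : i'.succ ≤ i.castSucc := Fin.castSucc_lt_iff_succ_le.1 hx
      revert hy
      by_cases h6 : j = 6
      · subst h6
        rw [match_six]
        exact fun hy => hy.2 (le_antisymm hle hy.1) h5
      by_cases h7 : j = 7
      · subst h7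
        rw [match_seven]
        exact fun hy => hy.2 (le_antisymm hle hy.1) h0
      have hm := fst_octagonMatch_le i'.castSucc h6 h7
      exact fun hy => absurd hx (hy.1.trans hm).not_gt
  · have hσ : ∀ {y : Fin (k + 1) × Fin 8}, (y.1 < i.castSucc ∨ y.1 = i.castSucc ∧
        (y.2 = 0 ∨ y.2 = 5)) → ¬(i.castSucc ≤ y.1 ∧ (y.1 = i.castSucc → y.2 ∉ A)) := by
      rintro y (hlt | ⟨he, h | h⟩) ⟨h1, h2⟩
      · exact absurd hlt h1.not_gt
      · exact h2 he (h ▸ h0)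
      · exact h2 he (h ▸ h5)
    refine ⟨j, hj, ?_⟩
    rcases hadj with rfl | rfl | rfl
    · exact .inl ⟨hy.2 rfl, hpos⟩
    · exact .inr (.inl ⟨hy.2 rfl, hpos⟩)
    · refine .inr (.inr ⟨hy.2, ?_, ?_, hpos⟩)
      · rintro rfl
        exact hσ (octagonMatch_zero_five _ (.inl rfl)) hy
      · rintro rfl
        exact hσ (octagonMatch_zero_five _ (.inr rfl)) hy

/-- Twice the correction term for an octagon, read off from the two edges that enter it. -/
def potential (m : Fin (k + 1) × Fin 8 → Fin (k + 1) × Fin 8 → ℕ) (i : Fin (k + 1)) : ℤ :=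
  2 * ((m (i, 0) (octagonMatch k (i, 0)) + 1) % 2 : ℕ) -
    (m (i, 0) (octagonMatch k (i, 0)) + m (i, 5) (octagonMatch k (i, 5)) : ℕ)

theorem weightedDegree_pos (h : IsTourWeight m) (i : Fin (k + 1)) (j : Fin 8) :
    0 < weightedDegree m (i, j) := by
  obtain ⟨x, rfl, y, -, hadj, hpos⟩ := h.crossing {(i, j)} (i, j) (i, j + 1) rfl (by simp)
  unfold weightedDegree
  rcases hadj with rfl | rfl | rfl <;> omega

theorem weightedDegree_castSucc (h : IsTourWeight m) (i : Fin k) (c : Fin (k + 1))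
    (hc : c = i.castSucc) :
    weightedDegree m (c, 0) = m (c, 0) (c, 1) + m (c, 7) (c, 0) +
      m (c, 0) (octagonMatch k (c, 0)) ∧
    weightedDegree m (c, 1) = m (c, 0) (c, 1) + m (c, 1) (c, 2) + m (c, 1) (c, 3) ∧
    weightedDegree m (c, 2) = m (c, 1) (c, 2) + m (c, 2) (c, 3) + m (c, 2) (c, 4) ∧
    weightedDegree m (c, 3) = m (c, 2) (c, 3) + m (c, 3) (c, 4) + m (c, 1) (c, 3) ∧
    weightedDegree m (c, 4) = m (c, 3) (c, 4) + m (c, 4) (c, 5) + m (c, 2) (c, 4) ∧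
    weightedDegree m (c, 5) = m (c, 4) (c, 5) + m (c, 5) (c, 6) +
      m (c, 5) (octagonMatch k (c, 5)) ∧
    weightedDegree m (c, 6) = m (c, 5) (c, 6) + m (c, 6) (c, 7) + m (i.succ, 5) (c, 6) ∧
    weightedDegree m (c, 7) = m (c, 6) (c, 7) + m (c, 7) (c, 0) + m (i.succ, 0) (c, 7) := by
  have e1 : octagonMatch k (c, 1) = (c, 3) := rfl
  have e2 : octagonMatch k (c, 2) = (c, 4) := hc ▸ match_two
  have e3 : octagonMatch k (c, 3) = (c, 1) := rfl
  have e4 : octagonMatch k (c, 4) = (c, 2) := hc ▸ match_four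
  have e6 : octagonMatch k (c, 6) = (i.succ, 5) := hc ▸ match_six
  have e7 : octagonMatch k (c, 7) = (i.succ, 0) := hc ▸ match_seven
  simp only [weightedDegree, e1, e2, e3, e4, e6, e7, show (0 - 1 : Fin 8) = 7 from rfl,
    show (0 + 1 : Fin 8) = 1 from rfl, show (1 - 1 : Fin 8) = 0 from rfl,
    show (1 + 1 : Fin 8) = 2 from rfl, show (2 - 1 : Fin 8) = 1 from rfl,
    show (2 + 1 : Fin 8) = 3 from rfl, show (3 - 1 : Fin 8) = 2 from rfl,
    show (3 + 1 : Fin 8) = 4 from rfl, show (4 - 1 : Fin 8) = 3 from rfl,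
    show (4 + 1 : Fin 8) = 5 from rfl, show (5 - 1 : Fin 8) = 4 from rfl,
    show (5 + 1 : Fin 8) = 6 from rfl, show (6 - 1 : Fin 8) = 5 from rfl,
    show (6 + 1 : Fin 8) = 7 from rfl, show (7 - 1 : Fin 8) = 6 from rfl,
    show (7 + 1 : Fin 8) = 0 from rfl]
  rw [h.symm (c, 0) (c, 7), h.symm (c, 1) (c, 0), h.symm (c, 2) (c, 1), h.symm (c, 3) (c, 2),
    h.symm (c, 3) (c, 1), h.symm (c, 4) (c, 3), h.symm (c, 4) (c, 2), h.symm (c, 5) (c, 4),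
    h.symm (c, 6) (c, 5), h.symm (c, 7) (c, 6), h.symm (c, 6) (i.succ, 5),
    h.symm (c, 7) (i.succ, 0)]
  refine ⟨?_, ?_, ?_, ?_, ?_, ?_, ?_, ?_⟩ <;> ring

/-- In the first octagon both entries are the same chord, counted twice. Summing the even degrees
over an octagon passes the parity on to the next pair of rails. -/
theorem even_entering (h : IsTourWeight m) (i : Fin (k + 1)) :
    Even (m (i, 0) (octagonMatch k (i, 0)) + m (i, 5) (octagonMatch k (i, 5))) := by
  induction i using Fin.induction with
  | zero =>
    have h0 : octagonMatch k (0, 0) = (0, 5) := by simp [octagonMatch]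
    have h5 : octagonMatch k (0, 5) = (0, 0) := by simp [octagonMatch]
    rw [h0, h5, h.symm (0, 5)]
    exact Even.add_self _
  | succ i ih =>
    rw [match_succ_zero, match_succ_five]
    obtain ⟨d0, d1, d2, d3, d4, d5, d6, d7⟩ := h.weightedDegree_castSucc i _ rfl
    have e0 := d0 ▸ h.even (i.castSucc, 0)
    have e1 := d1 ▸ h.even (i.castSucc, 1)
    have e2 := d2 ▸ h.even (i.castSucc, 2)
    have e3 := d3 ▸ h.even (i.castSucc, 3)
    have e4 := d4 ▸ h.even (i.castSucc, 4)
    have e5 := d5 ▸ h.even (i.castSucc, 5)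
    have e6 := d6 ▸ h.even (i.castSucc, 6)
    have e7 := d7 ▸ h.even (i.castSucc, 7)
    simp only [Nat.even_iff] at *
    omega

theorem cuts_pos (h : IsTourWeight m) (i : Fin k) (c : Fin (k + 1)) (hc : c = i.castSucc) :
    (0 < m (c, 0) (c, 1) ∨ 0 < m (c, 4) (c, 5)) ∧
    (0 < m (c, 1) (c, 2) ∨ 0 < m (c, 1) (c, 3) ∨ 0 < m (c, 4) (c, 5)) ∧
    (0 < m (c, 0) (c, 1) ∨ 0 < m (c, 3) (c, 4) ∨ 0 < m (c, 2) (c, 4)) ∧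
    (0 < m (c, 7) (c, 0) ∨ 0 < m (c, 5) (c, 6)) ∧
    (0 < m (i.succ, 0) (c, 7) ∨ 0 < m (i.succ, 5) (c, 6)) ∧
    (0 < m (c, 5) (c, 6) ∨ 0 < m (c, 6) (c, 7) ∨ 0 < m (i.succ, 0) (c, 7)) ∧
    (0 < m (c, 7) (c, 0) ∨ 0 < m (c, 6) (c, 7) ∨ 0 < m (i.succ, 5) (c, 6)) := by
  have left := fun A => h.exists_crossing_left i A
  have cell := fun A => h.exists_crossing_cell i.castSucc A
  have e2 : octagonMatch k (c, 2) = (c, 4) := hc ▸ match_two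
  have e4 : octagonMatch k (c, 4) = (c, 2) := hc ▸ match_four
  have e6 : octagonMatch k (c, 6) = (i.succ, 5) := hc ▸ match_six
  have e7 : octagonMatch k (c, 7) = (i.succ, 0) := hc ▸ match_seven
  have e1 : octagonMatch k (c, 1) = (c, 3) := rfl
  have e3 : octagonMatch k (c, 3) = (c, 1) := rfl
  rw [← hc] at left cell
  have c1234 : 0 < m (c, 1) (c, 0) ∨ 0 < m (c, 4) (c, 5) := by
    obtain ⟨j, hj, hx⟩ := cell {1, 2, 3, 4} (by simp) (by decide)
    simp only [Finset.mem_insert, Finset.mem_singleton] at hj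
    rcases hj with rfl | rfl | rfl | rfl <;> (try simp only [e1, e2, e3, e4] at hx) <;>
      rcases hx with ⟨h1, h2⟩ | ⟨h1, h2⟩ | ⟨h1, h2⟩ <;>
      first
      | exact absurd h1 (by decide)
      | exact .inl h2
      | exact .inr h2
  have c234 : 0 < m (c, 2) (c, 1) ∨ 0 < m (c, 3) (c, 1) ∨ 0 < m (c, 4) (c, 5) := by
    obtain ⟨j, hj, hx⟩ := cell {2, 3, 4} (by simp) (by decide)
    simp only [Finset.mem_insert, Finset.mem_singleton] at hj
    rcases hj with rfl | rfl | rfl <;> (try simp only [e2, e3, e4] at hx) <;>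
      rcases hx with ⟨h1, h2⟩ | ⟨h1, h2⟩ | ⟨h1, h2⟩ <;>
      first
      | exact absurd h1 (by decide)
      | exact .inl h2
      | exact .inr (.inl h2)
      | exact .inr (.inr h2)
  have c123 : 0 < m (c, 1) (c, 0) ∨ 0 < m (c, 3) (c, 4) ∨ 0 < m (c, 2) (c, 4) := by
    obtain ⟨j, hj, hx⟩ := cell {1, 2, 3} (by simp) (by decide)
    simp only [Finset.mem_insert, Finset.mem_singleton] at hj
    rcases hj with rfl | rfl | rfl <;> (try simp only [e1, e2, e3] at hx) <;>
      rcases hx with ⟨h1, h2⟩ | ⟨h1, h2⟩ | ⟨h1, h2⟩ <;>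
      first
      | exact absurd h1 (by decide)
      | exact .inl h2
      | exact .inr (.inl h2)
      | exact .inr (.inr h2)
  have cl : 0 < m (c, 0) (c, 7) ∨ 0 < m (c, 5) (c, 6) := by
    obtain ⟨j, hj, hx⟩ := left {0, 1, 2, 3, 4, 5} (by simp) (by simp)
    simp only [Finset.mem_insert, Finset.mem_singleton] at hj
    rcases hj with rfl | rfl | rfl | rfl | rfl | rfl <;>
      (try simp only [e1, e2, e3, e4] at hx) <;>
      rcases hx with ⟨h1, h2⟩ | ⟨h1, h2⟩ | ⟨h1, h0, h5, h2⟩ <;>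
      first
      | exact absurd h1 (by decide)
      | exact absurd rfl h0
      | exact absurd rfl h5
      | exact .inl h2
      | exact .inr h2
  have co : 0 < m (c, 7) (i.succ, 0) ∨ 0 < m (c, 6) (i.succ, 5) := by
    obtain ⟨j, hj, hx⟩ := left Finset.univ (by simp) (by simp)
    clear hj
    fin_cases j <;>
      rcases hx with ⟨h1, h2⟩ | ⟨h1, h2⟩ | ⟨h1, h0, h5, h2⟩ <;>
      first
      | exact absurd (Finset.mem_univ _) h1
      | exact absurd rfl h0
      | exact absurd rfl h5
      | exact absurd (Finset.mem_univ _) (h1 rfl)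
      | exact absurd (Finset.mem_univ _) (h1 (congrArg Prod.fst e2))
      | exact absurd (Finset.mem_univ _) (h1 (congrArg Prod.fst e4))
      | exact .inl (e7 ▸ h2)
      | exact .inr (e6 ▸ h2)
  have c7 : 0 < m (c, 5) (c, 6) ∨ 0 < m (c, 7) (c, 6) ∨ 0 < m (c, 7) (i.succ, 0) := by
    obtain ⟨j, hj, hx⟩ := left {0, 1, 2, 3, 4, 5, 7} (by simp) (by simp)
    simp only [Finset.mem_insert, Finset.mem_singleton] at hj
    rcases hj with rfl | rfl | rfl | rfl | rfl | rfl | rfl <;>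
      (try simp only [e1, e2, e3, e4, e7] at hx) <;>
      rcases hx with ⟨h1, h2⟩ | ⟨h1, h2⟩ | ⟨h1, h0, h5, h2⟩ <;>
      first
      | exact absurd h1 (by decide)
      | exact absurd rfl h0
      | exact absurd rfl h5
      | exact absurd (h1 rfl) (by simp)
      | exact .inl h2
      | exact .inr (.inl h2)
      | exact .inr (.inr h2)
  have c6 : 0 < m (c, 0) (c, 7) ∨ 0 < m (c, 6) (c, 7) ∨ 0 < m (c, 6) (i.succ, 5) := by
    obtain ⟨j, hj, hx⟩ := left {0, 1, 2, 3, 4, 5, 6} (by simp) (by simp)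
    simp only [Finset.mem_insert, Finset.mem_singleton] at hj
    rcases hj with rfl | rfl | rfl | rfl | rfl | rfl | rfl <;>
      (try simp only [e1, e2, e3, e4, e6] at hx) <;>
      rcases hx with ⟨h1, h2⟩ | ⟨h1, h2⟩ | ⟨h1, h0, h5, h2⟩ <;>
      first
      | exact absurd h1 (by decide)
      | exact absurd rfl h0
      | exact absurd rfl h5
      | exact absurd (h1 rfl) (by simp)
      | exact .inl h2
      | exact .inr (.inl h2)
      | exact .inr (.inr h2)
  rw [h.symm (c, 1) (c, 0)] at c1234 c123
  rw [h.symm (c, 2) (c, 1), h.symm (c, 3) (c, 1)] at c234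
  rw [h.symm (c, 0) (c, 7)] at cl c6
  rw [h.symm (c, 7) (c, 6)] at c7
  rw [h.symm (c, 7) (i.succ, 0)] at co c7
  rw [h.symm (c, 6) (i.succ, 5)] at co c6
  exact ⟨c1234, c234, c123, cl, co, c7, c6⟩

theorem potential_step (h : IsTourWeight m) (i : Fin k) :
    20 + potential m i.succ - potential m i.castSucc ≤
      (∑ j, weightedDegree m (i.castSucc, j) : ℕ) := by
  have hin := h.even_entering i.castSucc
  obtain ⟨c, hc⟩ : ∃ c, c = i.castSucc := ⟨_, rfl⟩
  obtain ⟨d0, d1, d2, d3, d4, d5, d6, d7⟩ := h.weightedDegree_castSucc i c hc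
  obtain ⟨c1234, c234, c123, cl, co, c7, c6⟩ := h.cuts_pos i c hc
  rw [← hc] at hin ⊢
  have key := block_inequality hin (d0 ▸ h.even _) (d1 ▸ h.even _) (d2 ▸ h.even _) (d3 ▸ h.even _)
    (d4 ▸ h.even _) (d5 ▸ h.even _) (d6 ▸ h.even _) (d7 ▸ h.even _)
    (d1 ▸ h.weightedDegree_pos _ _) (d2 ▸ h.weightedDegree_pos _ _)
    (d3 ▸ h.weightedDegree_pos _ _) (d4 ▸ h.weightedDegree_pos _ _) (by omega) (by omega)
    (by omega) (by omega) (by omega) (by omega) (by omega)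
    (d6 ▸ h.weightedDegree_pos _ _) (d7 ▸ h.weightedDegree_pos _ _)
  rw [Fin.sum_univ_eight, d0, d1, d2, d3, d4, d5, d6, d7]
  simp only [potential, match_succ_zero, match_succ_five, ← hc]
  omega

theorem le_sum_weightedDegree (h : IsTourWeight m) :
    20 * (k : ℤ) - 2 ≤ (∑ x, weightedDegree m x : ℕ) := by
  have key := mul_add_sub_le_sum_of_potential 20 k _ _ h.potential_step
  have h0 : potential m 0 ≤ 2 := by
    simp only [potential]
    omega
  -- The last octagon has different chords and only gets a trivial bound: the negative part of its
  -- potential is paid for by the degrees of `0` and `5`.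
  have hl : 0 ≤ potential m (Fin.last k) + (∑ j, weightedDegree m (Fin.last k, j) : ℕ) := by
    rw [Fin.sum_univ_eight]
    simp only [potential]
    have a0 : m (Fin.last k, 0) (octagonMatch k (Fin.last k, 0)) ≤
        weightedDegree m (Fin.last k, 0) := by
      unfold weightedDegree; omega
    have a5 : m (Fin.last k, 5) (octagonMatch k (Fin.last k, 5)) ≤
        weightedDegree m (Fin.last k, 5) := by
      unfold weightedDegree; omega
    omega
  rw [Fintype.sum_prod_type, Fin.sum_univ_castSucc]
  push_cast at key hl ⊢
  linarith

end IsTourWeight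

theorem isTourWeight_count {v : Fin (k + 1) × Fin 8} {w : (octagonChain k).Walk v v}
    (hw : w.IsTSPTour) : IsTourWeight fun x y => w.edges.count s(x, y) where
  symm x y := by rw [Sym2.eq_swap]
  even x := by
    have := w.even_sum_count_edges x
    rwa [sum_neighborFinset] at this
  crossing S _ _ ha hb := hw.exists_crossing S ha hb

theorem le_length_of_isTSPTour {v : Fin (k + 1) × Fin 8} {w : (octagonChain k).Walk v v}
    (hw : w.IsTSPTour) : 10 * (k : ℤ) - 1 ≤ w.length := by
  have h1 := (isTourWeight_count hw).le_sum_weightedDegree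
  have h2 := w.sum_sum_count_edges
  simp only [sum_neighborFinset] at h2
  simp only [weightedDegree] at h1
  rw [h2] at h1
  push_cast at h1
  linarith

theorem le_tsp : 10 * (k : ℤ) - 1 ≤ (octagonChain k).tsp := by
  obtain ⟨⟨v, w, hw, hl⟩, -⟩ := SimpleGraph.tsp_isLeast (octagonChain.isTwoConnected (k := k)).connected
  rw [← hl]
  exact le_length_of_isTSPTour hw

end octagonChain

/-! ### Choice of the length of the chain -/

theorem theorem1 (ε : ℝ) (hε : 0 < ε) :
    ∃ (V : Type) (_ : Fintype V) (_ : DecidableEq V) (G : SimpleGraph V)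
      (_ : DecidableRel G.Adj),
      G.IsTwoConnected ∧ G.IsPlanar ∧ G.IsRegularOfDegree 3 ∧
        (1.25 - ε) * (Fintype.card V : ℝ) ≤ (G.tsp : ℝ) := by
  -- With `8 (k + 1)` vertices the target is `1.25 * 8 (k + 1) = 10 k + 10`, which exceeds the
  -- proved bound `10 k - 1` by 11; the slack `8 (k + 1) ε` absorbs this once `k ε ≥ 11`.
  obtain ⟨k, hk⟩ := exists_nat_ge (11 / ε)
  refine ⟨Fin (k + 1) × Fin 8, inferInstance, inferInstance, octagonChain k, inferInstance,
    octagonChain.isTwoConnected, octagonChain.isPlanar, octagonChain.isRegularOfDegree, ?_⟩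
  have h : 10 * (k : ℝ) - 1 ≤ ((octagonChain k).tsp : ℝ) := by
    exact_mod_cast octagonChain.le_tsp (k := k)
  have h11 : 11 ≤ k * ε := (div_le_iff₀ hε).1 hk
  refine le_trans ?_ h
  simp only [Fintype.card_prod, Fintype.card_fin]
  push_cast
  nlinarith
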